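/- Equip $\mathbb{R}^n$ with its standard Euclidean structure. A subspace of $\mathbb{R}^n$ is called rational if it has a basis of vectors with rational coordinates; let $\mathfrak{R}_n(e)$ be the set of rational subspaces of dimension $e$. The height $H(B)$ of $B\in\mathfrak{R}_n(e)$ is the Euclidean norm of a vector $\Xi\in\mathbb{Z}^{\binom ne}$ with setwise coprime coordinates in the class of Plücker coordinates of $B$. For nonzero subspaces $A,B$ of $\mathbb{R}^n$ let $$\psi_1(A,B)=\min_{X\in A\setminus\{0\},\ Y\in B\setminus\{0\}}\sin\widehat{(X,Y)}$$ be the sine of the smallest angle between $A$ and $B$. A subspace $A$ is called $(e,1)$-irrational if $A\cap B=\{0\}$ for all $B\in\mathfrak{R}_n(e)$. For such an $A$, let $\mu_n(A|e)_1\in[0,+\infty]$ be the supremum of all $\beta>0$ such that $\psi_1(A,B)\le H(B)^{-\beta}$ holds for infinitely many $B\in\mathfrak{R}_n(e)$, and for $d,e\ge 1$ with $d+e\le n$ let $$\mathring{\mu}_n(d,e)_1=\inf_A \mu_n(A|e)_1,$$ where $A$ ranges over the $(e,1)$-irrational subspaces of $\mathbb{R}^n$ of dimension $d$. Theorem. Let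 $d\ge 2$ and $\ell\in\{1,\dots,d\}$. Then $$\mathring{\mu}_{2d}(d,\ell)_1\le \frac{2d^2}{2d-\ell}.$$ -/

import Mathlib

open scoped ENNReal

noncomputable section

namespace SubspaceApprox

/-- The space `ℝⁿ` with its standard Euclidean structure. -/
abbrev E (n : ℕ) : Type := EuclideanSpace ℝ (Fin n)

/-- A subspace of `ℝⁿ` is rational if it has a basis of vectors with rational coordinates. -/
def IsRational {n : ℕ} (B : Submodule ℝ (E n)) : Prop :=
  ∃ b : Module.Basis (Fin (Module.finrank ℝ B)) ℝ B, ∀ i k, ∃ q : ℚ, (b i : E n) k = (q : ℝ)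

/-- The set `𝔯_n(e)` of rational subspaces of `ℝⁿ` of dimension `e`. -/
def rationalSubspaces (n e : ℕ) : Set (Submodule ℝ (E n)) :=
  {B | IsRational B ∧ Module.finrank ℝ B = e}

/-- The set `ℑ_n(d,e)_j` of the `d`-dimensional subspaces `A` of `ℝⁿ` that are
`(e,j)`-irrational: `dim (A ∩ B) < j` for every rational subspace `B` of dimension `e`. -/
def irrationalSubspaces (n d e j : ℕ) : Set (Submodule ℝ (E n)) :=
  {A | Module.finrank ℝ A = d ∧
    ∀ B ∈ rationalSubspaces n e, Module.finrank ℝ (A ⊓ B : Submodule ℝ (E n)) < j}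

/-- The Plücker coordinates of a family of `e` vectors of `ℝⁿ`: the `e × e` minors, indexed by
the increasing sequences of `e` indices among `n`. -/
def plucker {n e : ℕ} (v : Fin e → E n) (S : Fin e ↪o Fin n) : ℝ :=
  (Matrix.of fun i k : Fin e => v i (S k)).det

/-- `Ξ` is an integer vector with setwise coprime coordinates in the class (up to a nonzero real
factor) of Plücker coordinates of the subspace `B`. -/
def IsPrimitivePlucker {n e : ℕ} (B : Submodule ℝ (E n)) (Ξ : (Fin e ↪o Fin n) → ℤ) : Prop :=
  Finset.univ.gcd Ξ = 1 ∧
    ∃ (v : Module.Basis (Fin e) ℝ B) (c : ℝ), c ≠ 0 ∧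
      ∀ S, (Ξ S : ℝ) = c * plucker (fun i => (v i : E n)) S

/-- The height `H(B)` of a rational subspace `B`: the Euclidean norm of a primitive integer vector
of Plücker coordinates of `B`. Such a vector exists and is unique up to sign, so the infimum is
over a one-element set. -/
def height {n : ℕ} (B : Submodule ℝ (E n)) : ℝ :=
  sInf {r | ∃ Ξ : (Fin (Module.finrank ℝ B) ↪o Fin n) → ℤ,
    IsPrimitivePlucker B Ξ ∧ r = Real.sqrt (∑ S, (Ξ S : ℝ) ^ 2)}

/-- The distance `ψ(X,Y)`: the sine of the angle between `X` and `Y`. -/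
def psiVec {n : ℕ} (X Y : E n) : ℝ := Real.sin (InnerProductGeometry.angle X Y)

/-- `ψ₁(A,B)`, the least value of `ψ(X,Y)` over nonzero `X ∈ A` and `Y ∈ B`. -/
def psiOne {n : ℕ} (A B : Submodule ℝ (E n)) : ℝ :=
  sInf {r | ∃ X ∈ A, ∃ Y ∈ B, X ≠ 0 ∧ Y ≠ 0 ∧ r = psiVec X Y}

/-- `ψ_j(A,B)` for `1 ≤ j ≤ min (dim A) (dim B)`, the sine of the `j`-th canonical angle. Given
unit vectors `X ∈ A`, `Y ∈ B` with `ψ(X,Y) = ψ₁(A,B)`, one continues with the orthogonal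
complements of `X` in `A` and of `Y` in `B`. The result does not depend on the choice of `X, Y`,
so the infimum over all choices is the common value. (The value at `j = 0` is not used.) -/
def psi {n : ℕ} : ℕ → Submodule ℝ (E n) → Submodule ℝ (E n) → ℝ
  | 0, _, _ => 0
  | 1, A, B => psiOne A B
  | j + 2, A, B => sInf {r | ∃ X ∈ A, ∃ Y ∈ B, ‖X‖ = 1 ∧ ‖Y‖ = 1 ∧ psiVec X Y = psiOne A B ∧
      r = psi (j + 1) (A ⊓ (Submodule.span ℝ {X})ᗮ) (B ⊓ (Submodule.span ℝ {Y})ᗮ)}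

/-- The exponent `μ_n(A|e)_j ∈ [0,+∞]`: the supremum of the `β > 0` such that
`ψ_j(A,B) ≤ 1 / H(B)^β` for infinitely many rational subspaces `B` of dimension `e`. -/
def exponent {n : ℕ} (A : Submodule ℝ (E n)) (e j : ℕ) : ℝ≥0∞ :=
  sSup {x | ∃ β : ℝ, 0 < β ∧
    {B | B ∈ rationalSubspaces n e ∧ psi j A B ≤ 1 / height B ^ β}.Infinite ∧
    x = ENNReal.ofReal β}

/-- `μ̊_n(d,e)_j`, the infimum of `μ_n(A|e)_j` over the `(e,j)`-irrational subspaces `A` of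
dimension `d`. -/
def minExponent (n d e j : ℕ) : ℝ≥0∞ :=
  ⨅ A ∈ irrationalSubspaces n d e j, exponent A e j

end SubspaceApprox

end

/-! It suffices to exhibit one badly approximable subspace. Take a real cyclic field `K` of degree
`n`, with Galois group generated by `σ`, and an integral basis `θ`. Let `L i` be the linear form
with coefficients `σ ^ i (θ k)`, and `A` the common kernel of `L 0, …, L (d - 1)`, of dimension `n -
d`.

Let `B` be rational of dimension `ℓ`. The determinants of the windows `L a, …, L (a + ℓ - 1)` on
`B`, scaled by primitive Plücker coordinates, are the conjugates `σ ^ a x` of one algebraic integer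
`x` of `K` (`exists_formDet_galForm_eq`). By Moore's criterion `x ≠ 0`
(`eq_zero_of_galForm_eq_zero`), so the product of its `n` conjugates has absolute value at least `1`
(`one_le_prod_conj`). Every conjugate is `O(H(B))`. For `a ≤ d - ℓ` the whole window vanishes on
`A`, which improves the bound to `O(H(B) ψ₁(A,B))` (`abs_formDet_galForm_le`). Hence `1 ≪ ψ₁(A,B) ^
(d - ℓ + 1) * H(B) ^ n`, and with Northcott's property the exponent of `A` is at most `n / (d - ℓ +
1)`. For `n = 2 * d` this is at most the claimed bound. -/

namespace SubspaceApprox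

/-! ### Real cyclic number fields -/

/-- For every `n ≥ 1` there is a real cyclic number field of degree `n`, given with a generator of
its Galois group. -/
theorem exists_real_cyclic_field (n : ℕ) (hn : 0 < n) :
    ∃ (K : Type) (_ : Field K) (_ : NumberField K) (σ : K ≃ₐ[ℚ] K) (_ : K →+* ℝ),
      Module.finrank ℚ K = n ∧ σ ^ n = 1 ∧ ∀ x, σ x = x → ∃ q : ℚ, algebraMap ℚ K q = x := by
  -- The field is the degree `n` subfield of the `p`-th cyclotomic field. The modulus `2 * n`, not
  -- just `n`, makes it real: an element of order at most `2` in a cyclic group of order `p - 1` is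
  -- then an `n`-th power, so complex conjugation fixes the subfield.
  obtain ⟨p, hp, -, hmod⟩ := Nat.exists_prime_gt_modEq_one (k := 2 * n) 0 (by omega)
  have : Fact p.Prime := ⟨hp⟩
  have : NeZero p := ⟨hp.ne_zero⟩
  have hdvd : 2 * n ∣ p - 1 := (Nat.modEq_iff_dvd' hp.one_le).1 hmod.symm
  have hp1 : 0 < p - 1 := by have := hp.two_le; omega
  have : NeZero (p : ℚ) := ⟨Nat.cast_ne_zero.2 hp.ne_zero⟩
  obtain ⟨L, _, _, _⟩ : ∃ (L : Type) (_ : Field L) (_ : CharZero L),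
      IsCyclotomicExtension {p} ℚ L :=
    ⟨CyclotomicField p ℚ, inferInstance, inferInstance, by
      convert CyclotomicField.isCyclotomicExtension p ℚ
      · rfl
      · exact Subsingleton.elim _ _⟩
  have : NumberField L := IsCyclotomicExtension.numberField {p} ℚ L
  have : IsGalois ℚ L := IsCyclotomicExtension.isGalois {p} ℚ L
  have e : (L ≃ₐ[ℚ] L) ≃* (ZMod p)ˣ := IsCyclotomicExtension.autEquivPow L
    (Polynomial.cyclotomic.irreducible_rat hp.pos)
  have hcard : Nat.card (L ≃ₐ[ℚ] L) = p - 1 := by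
    rw [Nat.card_congr e.toEquiv, Nat.card_eq_fintype_card, ZMod.card_units]
  have : IsCyclic (L ≃ₐ[ℚ] L) := isCyclic_of_surjective e.symm e.symm.surjective
  obtain ⟨g, hg⟩ := IsCyclic.exists_generator (α := L ≃ₐ[ℚ] L)
  have hord : orderOf g = p - 1 := by rw [orderOf_eq_card_of_forall_mem_zpowers hg, hcard]
  let H : Subgroup (L ≃ₐ[ℚ] L) := Subgroup.zpowers (g ^ n)
  have : H.Normal := by
    refine ⟨fun a ha b => ?_⟩
    obtain ⟨i, rfl⟩ := Subgroup.mem_zpowers_iff.1 (hg a)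
    obtain ⟨j, rfl⟩ := Subgroup.mem_zpowers_iff.1 (hg b)
    rwa [← zpow_add, add_comm, zpow_add, mul_inv_cancel_right]
  let K : IntermediateField ℚ L := IntermediateField.fixedField H
  have : IsGalois ℚ K := IsGalois.of_fixedField_normal_subgroup H
  have hmemK : ∀ x : L, x ∈ K ↔ ∀ h ∈ H, h x = x := fun x =>
    ⟨fun hx h hh => hx ⟨h, hh⟩, fun hx h => hx h.1 h.2⟩
  have hdeg : Module.finrank ℚ K = n := by
    have h1 : Module.finrank K L = (p - 1) / n := by
      rw [IntermediateField.finrank_fixedField_eq_card, Nat.card_zpowers,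
        orderOf_pow_of_dvd hn.ne' (hord ▸ (Dvd.intro_left 2 rfl).trans hdvd), hord]
    have h2 : Module.finrank ℚ L = p - 1 := by
      rw [← hcard, IsGalois.card_aut_eq_finrank]
    have h3 := Module.finrank_mul_finrank ℚ K L
    rw [h1, h2] at h3
    obtain ⟨q, hq⟩ := (Dvd.intro_left 2 rfl : n ∣ 2 * n).trans hdvd
    rw [hq, Nat.mul_div_cancel_left _ hn] at h3
    have hq0 : 0 < q := by
      rcases Nat.eq_zero_or_pos q with h | h
      · subst h; omega
      · exact h
    exact Nat.eq_of_mul_eq_mul_right hq0 h3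
  let σ : K ≃ₐ[ℚ] K := g.restrictNormal K
  have hσ : ∀ x : K, ((σ x : K) : L) = g x := fun x => g.restrictNormal_commutes K x
  have hσpow : ∀ (k : ℕ) (x : K), (((σ ^ k) x : K) : L) = (g ^ k) x := by
    intro k
    induction k with
    | zero => intro x; rfl
    | succ k ih =>
      intro x
      rw [pow_succ, pow_succ, AlgEquiv.mul_apply, AlgEquiv.mul_apply, ih, hσ]
  let φ : L →ₐ[ℚ] ℂ := IsAlgClosed.lift
  obtain ⟨c, hc⟩ : ∃ c : L ≃ₐ[ℚ] L, ∀ x, φ (c x) = (starRingEnd ℂ) (φ x) := by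
    let : Algebra L ℂ := φ.toRingHom.toAlgebra
    have : IsScalarTower ℚ L ℂ := IsScalarTower.of_algebraMap_eq fun q => (φ.commutes q).symm
    refine ⟨(Complex.conjAe.restrictScalars ℚ : ℂ ≃ₐ[ℚ] ℂ).restrictNormal L, fun x => ?_⟩
    exact AlgEquiv.restrictNormal_commutes (Complex.conjAe.restrictScalars ℚ : ℂ ≃ₐ[ℚ] ℂ) L x
  have hc2 : c ^ 2 = 1 := by
    ext x
    apply φ.toRingHom.injective
    change φ _ = φ _
    rw [pow_two, AlgEquiv.mul_apply, hc, hc, Complex.conj_conj]; rfl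
  have hcH : c ∈ H := by
    obtain ⟨k, rfl⟩ := Subgroup.mem_zpowers_iff.1 (hg c)
    have h1 : g ^ (k * 2) = 1 := by rw [zpow_mul]; exact_mod_cast hc2
    rw [← orderOf_dvd_iff_zpow_eq_one, hord] at h1
    have h2 : ((2 * n : ℕ) : ℤ) ∣ k * 2 := (Int.natCast_dvd_natCast.2 hdvd).trans h1
    obtain ⟨m, hm⟩ := h2
    refine Subgroup.mem_zpowers_iff.2 ⟨m, ?_⟩
    rw [← zpow_natCast, ← zpow_mul]
    congr 1
    push_cast at hm
    linarith
  have hreal : ∀ x : K, (φ x).im = 0 := fun x => by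
    rw [← Complex.conj_eq_iff_im, ← hc, (hmemK x).1 x.2 c hcH]
  let ι : K →+* ℝ :=
    { toFun := fun x => (φ x).re
      map_one' := by simp
      map_zero' := by simp
      map_mul' := fun x y => by simp [hreal]
      map_add' := fun x y => by simp }
  refine ⟨K, inferInstance, inferInstance, σ, ι, hdeg, ?_, fun x hx => ?_⟩
  · ext x
    rw [hσpow, (hmemK x).1 x.2 _ (Subgroup.mem_zpowers _)]; rfl
  · have h1 : g x = x := by rw [← hσ, hx]
    have h2 : (x : L) ∈ (⊥ : IntermediateField ℚ L) := by
      rw [IsGalois.mem_bot_iff_fixed]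
      intro f
      obtain ⟨k, rfl⟩ := Subgroup.mem_zpowers_iff.1 (hg f)
      have h3 : g ∈ MulAction.stabilizer (L ≃ₐ[ℚ] L) (x : L) := h1
      exact Subgroup.zpow_mem _ h3 k
    obtain ⟨q, hq⟩ := IntermediateField.mem_bot.1 h2
    exact ⟨q, Subtype.ext hq⟩

/-! ### Moore determinants -/

/-- Moore's criterion: if `w` is linearly independent over the fixed field `ℚ` of `σ`, then the
columns of `(σ ^ i (w j))` are linearly independent. -/
theorem moore_linearIndependent {K : Type*} [Field K] [Algebra ℚ K] (σ : K ≃ₐ[ℚ] K)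
    (hfix : ∀ x, σ x = x → ∃ q : ℚ, algebraMap ℚ K q = x) :
    ∀ (m : ℕ) (w : Fin m → K), LinearIndependent ℚ w → ∀ c : Fin m → K,
      (∀ i < m, ∑ j, c j * (σ ^ i) (w j) = 0) → c = 0 := by
  intro m
  induction m with
  | zero => intro w _ c _; exact Subsingleton.elim _ _
  | succ m ih =>
    intro w hw c hc
    have hw' : LinearIndependent ℚ fun j : Fin m => w j.castSucc :=
      hw.comp _ (Fin.castSucc_injective m)
    by_cases hlast : c (Fin.last m) = 0
    · have h0 : (fun j : Fin m => c j.castSucc) = 0 := by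
        refine ih _ hw' _ fun i hi => ?_
        have := hc i (by omega)
        rwa [Fin.sum_univ_castSucc, hlast, zero_mul, add_zero] at this
      funext j
      induction j using Fin.lastCases with
      | last => exact hlast
      | cast j => exact congrFun h0 j
    · exfalso
      set u : Fin (m + 1) → K := fun j => c j / c (Fin.last m) with hu
      have hu1 : u (Fin.last m) = 1 := div_self hlast
      have hc' : ∀ i < m + 1, ∑ j, u j * (σ ^ i) (w j) = 0 := fun i hi => by
        simp only [hu, div_mul_eq_mul_div, ← Finset.sum_div, hc i hi, zero_div]
      -- With last coefficient `1`, subtracting the image under `σ` of relation `i` from relation `i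
      -- + 1` cancels the last term. Induction then shows that every `u j` is fixed by `σ`, hence
      -- rational, and relation `0` contradicts independence.
      have h0 : (fun j : Fin m => σ.symm (u j.castSucc) - u j.castSucc) = 0 := by
        refine ih _ hw' _ fun i hi => ?_
        apply σ.injective
        have h1 := hc' (i + 1) (by omega)
        have h2 := congrArg σ (hc' i (by omega))
        rw [Fin.sum_univ_castSucc, hu1] at h1 h2
        simp only [map_add, map_sum, map_mul, map_zero, map_sub, map_one,
          AlgEquiv.apply_symm_apply, pow_succ', AlgEquiv.mul_apply, sub_mul,
          Finset.sum_sub_distrib] at h1 h2 ⊢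
        linear_combination h1 - h2
      have h1 : ∀ j, ∃ q : ℚ, algebraMap ℚ K q = u j := fun j => by
        induction j using Fin.lastCases with
        | last => exact ⟨1, by rw [hu1, map_one]⟩
        | cast j =>
          refine hfix _ ?_
          have := congrFun h0 j
          simp only [Pi.zero_apply, sub_eq_zero] at this
          conv_lhs => rw [← this]
          exact σ.apply_symm_apply _
      choose q hq using h1
      have h2 := hc' 0 (by omega)
      simp only [← hq, pow_zero, AlgEquiv.one_apply, ← Algebra.smul_def] at h2
      have h3 := Fintype.linearIndependent_iff.1 hw q h2 (Fin.last m)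
      have h4 := hq (Fin.last m)
      rw [h3, map_zero, hu1] at h4
      exact zero_ne_one h4

theorem moore_det_ne_zero {K : Type*} [Field K] [Algebra ℚ K] (σ : K ≃ₐ[ℚ] K)
    (hfix : ∀ x, σ x = x → ∃ q : ℚ, algebraMap ℚ K q = x) {m : ℕ} (w : Fin m → K)
    (hw : LinearIndependent ℚ w) (a : ℕ) :
    (Matrix.of fun i j : Fin m => (σ ^ (a + (i : ℕ))) (w j)).det ≠ 0 := by
  have key : (Matrix.of fun i j : Fin m => (σ ^ (i : ℕ)) (w j)).det ≠ 0 := by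
    intro h
    obtain ⟨c, hc0, hc⟩ := Matrix.exists_mulVec_eq_zero_iff.2 h
    refine hc0 (moore_linearIndependent σ hfix m w hw c fun i hi => ?_)
    have := congrFun hc ⟨i, hi⟩
    simpa [Matrix.mulVec, dotProduct, mul_comm] using this
  have h : (Matrix.of fun i j : Fin m => (σ ^ (a + (i : ℕ))) (w j)) =
      ((σ ^ a : K ≃ₐ[ℚ] K) : K →+* K).mapMatrix
        (Matrix.of fun i j : Fin m => (σ ^ (i : ℕ)) (w j)) := by
    ext i j
    simp [pow_add]
  rw [h, ← RingHom.map_det]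
  exact fun h0 => key ((map_eq_zero _).1 h0)

/-! ### Determinants of linear forms and Plücker coordinates -/

open Module Finset

/-- The determinant of the values of `ℓ` linear forms at `ℓ` vectors. -/
noncomputable def formDet {n ℓ : ℕ} (f : Fin ℓ → E n →ₗ[ℝ] ℝ) (v : Fin ℓ → E n) : ℝ :=
  (Matrix.of fun j i : Fin ℓ => f i (v j)).det

/-- The `k`-th coordinate form. -/
noncomputable def coordForm {n : ℕ} (k : Fin n) : E n →ₗ[ℝ] ℝ :=
  (EuclideanSpace.proj k : E n →L[ℝ] ℝ).toLinearMap

@[simp] theorem coordForm_apply {n : ℕ} (k : Fin n) (x : E n) : coordForm k x = x k := rfl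

theorem form_eq_sum_coordForm {n : ℕ} (f : E n →ₗ[ℝ] ℝ) :
    f = ∑ k, f (EuclideanSpace.single k 1) • coordForm k := by
  refine (EuclideanSpace.basisFun (Fin n) ℝ).toBasis.ext fun k => ?_
  simp [LinearMap.sum_apply, PiLp.single_apply]

theorem formDet_eq_sum {n ℓ : ℕ} (f : Fin ℓ → E n →ₗ[ℝ] ℝ) (v : Fin ℓ → E n) :
    formDet f v = ∑ κ : Fin ℓ → Fin n, (∏ i, f i (EuclideanSpace.single (κ i) 1)) *
      formDet (fun i => coordForm (κ i)) v := by
  have h : ∀ g : Fin ℓ → E n →ₗ[ℝ] ℝ,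
      formDet g v = Matrix.detRowAlternating fun i : Fin ℓ => fun j => g i (v j) :=
    fun g => (Matrix.det_transpose (Matrix.of fun j i : Fin ℓ => g i (v j))).symm
  have h2 : (fun i : Fin ℓ => fun j => f i (v j)) = fun i => ∑ k,
      f i (EuclideanSpace.single k 1) • fun j => v j k := by
    funext i j
    conv_lhs => rw [form_eq_sum_coordForm (f i)]
    simp [LinearMap.sum_apply]
  rw [h, h2]
  have := (Matrix.detRowAlternating (R := ℝ) (n := Fin ℓ)).toMultilinearMap.map_sum
    (g := fun i k => f i (EuclideanSpace.single k 1) • fun j => v j k)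
  refine this.trans (sum_congr rfl fun κ _ => ?_)
  rw [MultilinearMap.map_smul_univ, h]
  rfl

/-- Cramer's rule for linear forms on the span of `v`. -/
theorem formDet_cramer {n ℓ : ℕ} (f : Fin ℓ → E n →ₗ[ℝ] ℝ) (g : E n →ₗ[ℝ] ℝ)
    (v : Fin ℓ → E n) {y : E n} (hy : y ∈ Submodule.span ℝ (Set.range v)) :
    g y * formDet f v = ∑ i, f i y * formDet (Function.update f i g) v := by
  have key : ∀ j, g (v j) * formDet f v =
      ∑ i, f i (v j) * formDet (Function.update f i g) v := by
    intro j
    have h := congrFun (Matrix.mulVec_cramer (Matrix.of fun j i : Fin ℓ => f i (v j))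
      fun j => g (v j)) j
    simp only [Matrix.mulVec, dotProduct, Pi.smul_apply, smul_eq_mul, Matrix.cramer_apply,
      Matrix.of_apply] at h
    rw [mul_comm, formDet, ← h]
    refine sum_congr rfl fun i _ => ?_
    congr 2
    ext a b
    by_cases hb : b = i
    · subst hb; simp
    · simp [hb]
  induction hy using Submodule.span_induction with
  | mem x hx => obtain ⟨j, rfl⟩ := hx; exact key j
  | zero => simp
  | add x y _ _ hx hy => simp only [map_add, add_mul, sum_add_distrib, hx, hy]
  | smul a x _ hx => simp only [map_smul, smul_eq_mul, mul_assoc, ← mul_sum, hx]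

/-- Every `ℓ × ℓ` minor is, up to sign, zero or a Plücker coordinate. -/
theorem formDet_coordForm_eq {n ℓ : ℕ} (κ : Fin ℓ → Fin n) :
    (∀ v : Fin ℓ → E n, formDet (fun i => coordForm (κ i)) v = 0) ∨
    ∃ (S : Fin ℓ ↪o Fin n) (ε : ℤ), |ε| = 1 ∧
      ∀ v : Fin ℓ → E n, formDet (fun i => coordForm (κ i)) v = ε * plucker v S := by
  by_cases hκ : Function.Injective κ
  · right
    let τ := Tuple.sort κ
    have hmono : StrictMono (κ ∘ τ) :=
      (Tuple.monotone_sort κ).strictMono_of_injective (hκ.comp τ.injective)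
    refine ⟨OrderEmbedding.ofStrictMono _ hmono, (Equiv.Perm.sign τ : ℤ), ?_, fun v => ?_⟩
    · rcases Int.units_eq_one_or (Equiv.Perm.sign τ) with h | h <;> simp [h]
    · have h := Matrix.det_permute' τ (Matrix.of fun j i : Fin ℓ => v j (κ i))
      have h2 : plucker v (OrderEmbedding.ofStrictMono _ hmono) =
          ((Equiv.Perm.sign τ : ℤ) : ℝ) * formDet (fun i => coordForm (κ i)) v := h
      rw [h2, ← mul_assoc]
      rcases Int.units_eq_one_or (Equiv.Perm.sign τ) with h | h <;> simp [h]
  · left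
    intro v
    obtain ⟨i, j, hij, hne⟩ : ∃ i j, κ i = κ j ∧ i ≠ j := by
      simpa [Function.Injective] using hκ
    refine Matrix.det_zero_of_column_eq hne fun k => ?_
    simp [hij]

/-- A primitive vector extended to all `ℓ`-tuples of indices. -/
theorem exists_int_minor {n ℓ : ℕ} (Ξ : (Fin ℓ ↪o Fin n) → ℤ) (κ : Fin ℓ → Fin n) :
    ∃ z : ℤ, |(z : ℝ)| ≤ √(∑ S, (Ξ S : ℝ) ^ 2) ∧ ∀ (v : Fin ℓ → E n) (c : ℝ),
      (∀ S, (Ξ S : ℝ) = c * plucker v S) → c * formDet (fun i => coordForm (κ i)) v = z := by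
  rcases formDet_coordForm_eq κ with h | ⟨S, ε, hε, h⟩
  · exact ⟨0, by simp, fun v c _ => by simp [h]⟩
  · refine ⟨ε * Ξ S, ?_, fun v c hc => ?_⟩
    · rw [← Int.cast_abs, abs_mul, hε, one_mul, Int.cast_abs]
      apply Real.abs_le_sqrt
      exact single_le_sum (f := fun S => (Ξ S : ℝ) ^ 2) (fun _ _ => sq_nonneg _) (mem_univ S)
    · push_cast
      rw [h, hc]; ring

theorem formDet_bound {n ℓ : ℕ} (Ξ : (Fin ℓ ↪o Fin n) → ℤ) (v : Fin ℓ → E n) (c : ℝ)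
    (hc : ∀ S, (Ξ S : ℝ) = c * plucker v S) (f : Fin ℓ → E n →ₗ[ℝ] ℝ) {C : ℝ}
    (hf : ∀ i k, |f i (EuclideanSpace.single k 1)| ≤ C) :
    |c * formDet f v| ≤ n ^ ℓ * C ^ ℓ * √(∑ S, (Ξ S : ℝ) ^ 2) := by
  rw [formDet_eq_sum, mul_sum]
  refine (abs_sum_le_sum_abs _ _).trans ?_
  have : ∀ κ ∈ (univ : Finset (Fin ℓ → Fin n)),
      |c * ((∏ i, f i (EuclideanSpace.single (κ i) 1)) *
        formDet (fun i => coordForm (κ i)) v)| ≤ C ^ ℓ * √(∑ S, (Ξ S : ℝ) ^ 2) := by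
    intro κ _
    obtain ⟨z, hz, h⟩ := exists_int_minor Ξ κ
    rw [mul_left_comm, h v c hc, abs_mul, abs_prod]
    refine mul_le_mul ?_ hz (abs_nonneg _) ?_
    · refine (prod_le_prod (fun _ _ => abs_nonneg _) fun i _ => hf i (κ i)).trans ?_
      simp
    · rcases Nat.eq_zero_or_pos ℓ with h0 | h0
      · subst h0; simp
      · exact pow_nonneg ((abs_nonneg _).trans (hf ⟨0, h0⟩ (κ ⟨0, h0⟩))) _
  refine (sum_le_sum this).trans ?_
  simp [mul_assoc]

theorem span_range_basis {n : ℕ} {B : Submodule ℝ (E n)} {ι : Type*} (v : Basis ι ℝ B) :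
    Submodule.span ℝ (Set.range fun i => (v i : E n)) = B := by
  have h := congrArg (Submodule.map B.subtype) v.span_eq
  rw [Submodule.map_span, Submodule.map_top, Submodule.range_subtype, ← Set.range_comp] at h
  exact h

/-- If the forms `f` have no common zero on `B` other than `0` and `B` has dimension `ℓ`,
then their determinant on a basis is nonzero, and conversely. -/
theorem formDet_ne_zero_iff {n ℓ : ℕ} {B : Submodule ℝ (E n)} (v : Basis (Fin ℓ) ℝ B)
    (f : Fin ℓ → E n →ₗ[ℝ] ℝ) :
    formDet f (fun j => (v j : E n)) ≠ 0 ↔ ∀ y ∈ B, (∀ i, f i y = 0) → y = 0 := by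
  constructor
  · intro h y hy hf
    ext k
    have h1 := formDet_cramer f (coordForm k) (fun j => (v j : E n))
      (y := y) (by rwa [span_range_basis])
    simp only [hf, zero_mul, sum_const_zero, mul_eq_zero, h, or_false] at h1
    exact h1
  · intro h h0
    obtain ⟨a, ha, hv⟩ := Matrix.exists_vecMul_eq_zero_iff.2 h0
    have h1 : (∑ j, a j • v j : B) = 0 := by
      apply Subtype.ext
      refine h _ (Subtype.mem _) fun i => ?_
      have := congrFun hv i
      simpa [Matrix.vecMul, dotProduct] using this
    exact ha (funext fun j => Fintype.linearIndependent_iff.1 v.linearIndependent a h1 j)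

/-- The dual basis, extended to the whole space by a retraction onto `B`, has nonzero determinant on
`v`; this determinant is a combination of Plücker coordinates. -/
theorem exists_plucker_ne_zero {n ℓ : ℕ} {B : Submodule ℝ (E n)} (v : Basis (Fin ℓ) ℝ B) :
    ∃ S, plucker (fun j => (v j : E n)) S ≠ 0 := by
  by_contra! h
  obtain ⟨g, hg⟩ := B.subtype.exists_leftInverse_of_injective B.ker_subtype
  have h1 : formDet (fun i => (v.coord i).comp g) (fun j => (v j : E n)) ≠ 0 := by
    rw [formDet_ne_zero_iff]
    intro y hy h0
    have h2 : g y = ⟨y, hy⟩ := LinearMap.congr_fun hg ⟨y, hy⟩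
    have h3 : (⟨y, hy⟩ : B) = 0 := by
      rw [← h2]
      exact v.ext_elem fun i => by simpa using h0 i
    exact congrArg Subtype.val h3
  apply h1
  rw [formDet_eq_sum]
  refine sum_eq_zero fun κ _ => ?_
  rcases formDet_coordForm_eq κ with h2 | ⟨S, ε, -, h2⟩
  · rw [h2, mul_zero]
  · rw [h2, h, mul_zero, mul_zero]

/-- A subspace is determined by its Plücker coordinates. -/
theorem eq_of_plucker_eq {n ℓ : ℕ} {B B' : Submodule ℝ (E n)} (Ξ : (Fin ℓ ↪o Fin n) → ℤ)
    (h : Module.finrank ℝ B = ℓ) (h' : Module.finrank ℝ B' = ℓ)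
    (v : Basis (Fin ℓ) ℝ B) (c : ℝ) (hc0 : c ≠ 0)
    (hc : ∀ S, (Ξ S : ℝ) = c * plucker (fun i => (v i : E n)) S)
    (v' : Basis (Fin ℓ) ℝ B') (c' : ℝ) 
    (hc' : ∀ S, (Ξ S : ℝ) = c' * plucker (fun i => (v' i : E n)) S) : B = B' := by
  obtain ⟨S, hS⟩ := exists_plucker_ne_zero v
  have hΞ : (Ξ S : ℝ) ≠ 0 := by rw [hc]; exact mul_ne_zero hc0 hS
  let F : Fin ℓ → E n →ₗ[ℝ] ℝ := fun i => coordForm (S i)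
  have hup : ∀ i k, Function.update F i (coordForm k) =
      fun a => coordForm (Function.update S i k a) := by
    intro i k
    funext a
    by_cases ha : a = i
    · subst ha; simp
    · simp [ha, F]
  choose z _ hz using exists_int_minor Ξ
  -- Cramer's rule in the pivot coordinates `S` gives equations with coefficients depending on `Ξ`
  -- only. A point of `W` is determined by its coordinates in `S`, so `W` has dimension at most `ℓ`
  -- and equals both `B` and `B'`.
  let W : Submodule ℝ (E n) := ⨅ k, LinearMap.ker
    ((Ξ S : ℝ) • coordForm k - ∑ i, (z (Function.update S i k) : ℝ) • coordForm (S i))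
  have hW : ∀ y, y ∈ W ↔ ∀ k, (Ξ S : ℝ) * y k = ∑ i, z (Function.update S i k) * y (S i) := by
    intro y
    simp [W, Submodule.mem_iInf, LinearMap.sum_apply, sub_eq_zero]
  have hsub : ∀ (B : Submodule ℝ (E n)) (v : Basis (Fin ℓ) ℝ B) (c : ℝ),
      (∀ S, (Ξ S : ℝ) = c * plucker (fun i => (v i : E n)) S) → B ≤ W := by
    intro B v c hc y hy
    rw [hW]
    intro k
    have h1 := formDet_cramer F (coordForm k) (fun j => (v j : E n))
      (y := y) (by rwa [span_range_basis])
    have h2 : (Ξ S : ℝ) = c * formDet F (fun j => (v j : E n)) := hc S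
    simp only [hup] at h1
    rw [h2, mul_assoc, mul_comm (formDet _ _)]
    change c * (coordForm k y * _) = _
    rw [h1, mul_sum]
    refine sum_congr rfl fun i _ => ?_
    rw [← hz _ _ c hc]
    simp only [F, coordForm_apply]
    ring
  have hdim : Module.finrank ℝ W ≤ ℓ := by
    let G : W →ₗ[ℝ] (Fin ℓ → ℝ) := (LinearMap.pi F).comp W.subtype
    have hG : Function.Injective G := by
      rw [← LinearMap.ker_eq_bot, LinearMap.ker_eq_bot']
      intro y hy
      apply Subtype.ext
      ext k
      have h1 := (hW y).1 y.2 k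
      have h2 : ∀ i, (y : E n) (S i) = 0 := fun i => congrFun hy i
      simp only [h2, mul_zero, sum_const_zero, mul_eq_zero, hΞ, false_or] at h1
      exact h1
    simpa using LinearMap.finrank_le_finrank_of_injective hG
  rw [Submodule.eq_of_le_of_finrank_le (hsub B v c hc) (hdim.trans h.ge),
    Submodule.eq_of_le_of_finrank_le (hsub B' v' c' hc') (hdim.trans h'.ge)]

/-! ### Heights and Northcott's property -/

theorem IsPrimitivePlucker.one_le_norm {n e : ℕ} {B : Submodule ℝ (E n)}
    {Ξ : (Fin e ↪o Fin n) → ℤ} (h : IsPrimitivePlucker B Ξ) : 1 ≤ √(∑ S, (Ξ S : ℝ) ^ 2) := by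
  have h1 : ∃ S, Ξ S ≠ 0 := by
    by_contra! h0
    have : univ.gcd Ξ = 0 := gcd_eq_zero_iff.2 fun S _ => h0 S
    rw [h.1] at this
    exact one_ne_zero this
  obtain ⟨S, hS⟩ := h1
  rw [Real.one_le_sqrt]
  have h2 : (1 : ℝ) ≤ (Ξ S : ℝ) ^ 2 := by
    exact_mod_cast Int.add_one_le_iff.2 (sq_pos_of_ne_zero hS)
  exact h2.trans (single_le_sum (f := fun S => (Ξ S : ℝ) ^ 2) (fun _ _ => sq_nonneg _)
    (mem_univ S))

theorem IsRational.exists_isPrimitivePlucker {n : ℕ} {B : Submodule ℝ (E n)}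
    (hB : IsRational B) : ∃ Ξ : (Fin (finrank ℝ B) ↪o Fin n) → ℤ, IsPrimitivePlucker B Ξ := by
  obtain ⟨b, hb⟩ := hB
  choose q hq using hb
  let r : (Fin (finrank ℝ B) ↪o Fin n) → ℚ := fun S =>
    (Matrix.of fun i k : Fin (finrank ℝ B) => q i (S k)).det
  have hr : ∀ S, plucker (fun i => (b i : E n)) S = r S := by
    intro S
    have := (Rat.castHom ℝ).map_det (Matrix.of fun i k : Fin (finrank ℝ B) => q i (S k))
    refine Eq.trans ?_ this.symm
    unfold plucker
    congr 1
    ext i k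
    simp [hq]
  obtain ⟨S₀, hS₀⟩ := exists_plucker_ne_zero b
  obtain ⟨D, hD⟩ := IsLocalization.exist_integer_multiples_of_finite (nonZeroDivisors ℤ) r
  choose z hz using hD
  have hz' : ∀ S, (z S : ℝ) = (D : ℤ) * r S := fun S => by
    have := hz S
    rw [Algebra.smul_def] at this
    exact_mod_cast congrArg (Rat.cast : ℚ → ℝ) this
  have hD0 : ((D : ℤ) : ℝ) ≠ 0 := Int.cast_ne_zero.2 (nonZeroDivisors.ne_zero D.2)
  obtain ⟨Ξ, hΞ, hgcd⟩ := extract_gcd z (⟨S₀, mem_univ _⟩ : (univ : Finset _).Nonempty)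
  have hg0 : ((univ.gcd z : ℤ) : ℝ) ≠ 0 := by
    rw [Int.cast_ne_zero]
    intro h0
    have h1 : z S₀ = 0 := gcd_eq_zero_iff.1 h0 S₀ (mem_univ _)
    have h2 := hz' S₀
    rw [h1, Int.cast_zero, ← hr] at h2
    exact (mul_ne_zero hD0 hS₀) h2.symm
  refine ⟨Ξ, hgcd, b, (D : ℤ) / (univ.gcd z : ℤ), div_ne_zero hD0 hg0, fun S => ?_⟩
  rw [hr, div_mul_eq_mul_div, ← hz', hΞ S (mem_univ _), Int.cast_mul, mul_div_cancel_left₀ _ hg0]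

theorem IsRational.one_le_height {n : ℕ} {B : Submodule ℝ (E n)} (hB : IsRational B) :
    1 ≤ height B := by
  obtain ⟨Ξ, hΞ⟩ := hB.exists_isPrimitivePlucker
  refine le_csInf ⟨_, Ξ, hΞ, rfl⟩ ?_
  rintro _ ⟨Ξ, h, rfl⟩
  exact h.one_le_norm

/-- The factor `2` spares proving that the infimum defining the height is attained; constants do not
affect exponents. -/
theorem exists_isPrimitivePlucker_norm_le {n ℓ : ℕ} {B : Submodule ℝ (E n)}
    (hB : B ∈ rationalSubspaces n ℓ) : ∃ Ξ : (Fin ℓ ↪o Fin n) → ℤ, IsPrimitivePlucker B Ξ ∧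
      √(∑ S, (Ξ S : ℝ) ^ 2) ≤ 2 * height B := by
  obtain ⟨hB, rfl⟩ := hB
  have h1 := hB.one_le_height
  obtain ⟨Ξ₀, hΞ₀⟩ := hB.exists_isPrimitivePlucker
  obtain ⟨_, ⟨Ξ, hΞ, rfl⟩, hlt⟩ := exists_lt_of_csInf_lt
    (s := {r | ∃ Ξ : (Fin (finrank ℝ B) ↪o Fin n) → ℤ,
      IsPrimitivePlucker B Ξ ∧ r = √(∑ S, (Ξ S : ℝ) ^ 2)})
    ⟨_, Ξ₀, hΞ₀, rfl⟩ (show height B < 2 * height B by linarith)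
  exact ⟨Ξ, hΞ, hlt.le⟩

/-- Northcott's property of the height. -/
theorem finite_height_le (n ℓ : ℕ) (T : ℝ) :
    {B | B ∈ rationalSubspaces n ℓ ∧ height B ≤ T}.Finite := by
  have hex : ∀ B : Submodule ℝ (E n), ∃ Ξ : (Fin ℓ ↪o Fin n) → ℤ,
      B ∈ rationalSubspaces n ℓ → IsPrimitivePlucker B Ξ ∧
        √(∑ S, (Ξ S : ℝ) ^ 2) ≤ 2 * height B := by
    intro B
    by_cases hB : B ∈ rationalSubspaces n ℓ
    · obtain ⟨Ξ, h⟩ := exists_isPrimitivePlucker_norm_le hB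
      exact ⟨Ξ, fun _ => h⟩
    · exact ⟨0, fun h => absurd h hB⟩
  choose Ξ hΞ using hex
  refine Set.Finite.of_injOn (f := Ξ)
    (t := Set.pi Set.univ fun _ => Set.Icc (-⌈2 * T⌉) ⌈2 * T⌉) ?_ ?_
    (Set.Finite.pi fun _ => Set.finite_Icc _ _)
  · rintro B ⟨hB, hT⟩ S -
    have h1 : |(Ξ B S : ℝ)| ≤ √(∑ S, (Ξ B S : ℝ) ^ 2) := Real.abs_le_sqrt
      (single_le_sum (f := fun S => (Ξ B S : ℝ) ^ 2) (fun _ _ => sq_nonneg _) (mem_univ S))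
    have h2 : |(Ξ B S : ℝ)| ≤ (⌈2 * T⌉ : ℤ) := by
      have := (hΞ B hB).2
      have := Int.le_ceil (2 * T)
      linarith
    exact abs_le.1 (by exact_mod_cast h2)
  · rintro B ⟨hB, -⟩ B' ⟨hB', -⟩ heq
    obtain ⟨-, v, c, hc0, hc⟩ := (hΞ B hB).1
    obtain ⟨-, v', c', -, hc'⟩ := (hΞ B' hB').1
    exact eq_of_plucker_eq (Ξ B) hB.2 hB'.2 v c hc0 hc v' c' (by rwa [heq])

/-! ### Angles and norms -/

theorem exists_norm_sub_smul_eq {n : ℕ} {X : E n} (hX : X ≠ 0) (Y : E n) :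
    ∃ t : ℝ, ‖Y - t • X‖ = psiVec X Y * ‖Y‖ := by
  have hX' : ‖X‖ ≠ 0 := norm_ne_zero_iff.2 hX
  -- This is the coefficient of the orthogonal projection of `Y` onto the line of `X`.
  refine ⟨inner ℝ X Y / ‖X‖ ^ 2, ?_⟩
  have h0 : 0 ≤ psiVec X Y := InnerProductGeometry.sin_angle_nonneg _ _
  rw [← pow_left_inj₀ (norm_nonneg _) (by positivity) two_ne_zero, norm_sub_sq_real, mul_pow]
  have h1 : psiVec X Y ^ 2 = 1 - Real.cos (InnerProductGeometry.angle X Y) ^ 2 := Real.sin_sq _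
  have h2 := InnerProductGeometry.cos_angle_mul_norm_mul_norm X Y
  rw [h1, inner_smul_right, real_inner_comm X Y, norm_smul, mul_pow, Real.norm_eq_abs, sq_abs, ← h2]
  field_simp
  ring

theorem norm_le_sum_abs {n : ℕ} (Y : E n) : ‖Y‖ ≤ ∑ k, |Y k| := by
  conv_lhs => rw [← (EuclideanSpace.basisFun (Fin n) ℝ).sum_repr Y]
  refine (norm_sum_le _ _).trans (sum_le_sum fun k _ => ?_)
  simp [norm_smul]

/-! ### Conjugate linear forms and their common kernel -/

section GalForm

variable {K : Type} [Field K] [NumberField K] (σ : K ≃ₐ[ℚ] K) (ι : K →+* ℝ) {n : ℕ}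
  (θ : Basis (Fin n) ℚ K)

/-- The conjugate `σ ^ i` of the linear form on `ℝⁿ` whose coefficients are the basis `θ`. -/
noncomputable def galForm (i : ℕ) : E n →ₗ[ℝ] ℝ :=
  ∑ k, ι ((σ ^ i) (θ k)) • coordForm k

theorem galForm_apply (i : ℕ) (x : E n) :
    galForm σ ι θ i x = ∑ k, ι ((σ ^ i) (θ k)) * x k := by
  simp [galForm, LinearMap.sum_apply]

theorem galForm_single (i : ℕ) (k : Fin n) :
    galForm σ ι θ i (EuclideanSpace.single k 1) = ι ((σ ^ i) (θ k)) := by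
  simp [galForm_apply, PiLp.single_apply]

/-- The common kernel of the first `d` conjugate forms. -/
noncomputable def galSubspace (d : ℕ) : Submodule ℝ (E n) :=
  LinearMap.ker (LinearMap.pi fun i : Fin d => galForm σ ι θ i)

theorem mem_galSubspace {d : ℕ} {x : E n} :
    x ∈ galSubspace σ ι θ d ↔ ∀ i < d, galForm σ ι θ i x = 0 := by
  simp only [galSubspace, LinearMap.mem_ker, funext_iff, LinearMap.pi_apply, Pi.zero_apply]
  exact ⟨fun h i hi => h ⟨i, hi⟩, fun h i => h i i.2⟩

variable (hfix : ∀ x, σ x = x → ∃ q : ℚ, algebraMap ℚ K q = x)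
include hfix

theorem finrank_galSubspace {d : ℕ} (hd : d ≤ n) :
    finrank ℝ (galSubspace σ ι θ d) = n - d := by
  let Φ : E n →ₗ[ℝ] (Fin d → ℝ) := LinearMap.pi fun i : Fin d => galForm σ ι θ i
  have hdet := moore_det_ne_zero σ hfix (fun j : Fin d => θ (Fin.castLE hd j))
    (θ.linearIndependent.comp _ (Fin.castLE_injective hd)) 0
  let M : Matrix (Fin d) (Fin d) ℝ := ι.mapMatrix
    (Matrix.of fun i j : Fin d => (σ ^ (0 + (i : ℕ))) (θ (Fin.castLE hd j)))
  have hM : IsUnit M.det := by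
    rw [← RingHom.map_det]
    exact isUnit_iff_ne_zero.2 fun h => hdet ((map_eq_zero _).1 h)
  have hsurj : Function.Surjective Φ := by
    intro y
    refine ⟨∑ j, (M⁻¹.mulVec y) j • EuclideanSpace.single (Fin.castLE hd j) (1 : ℝ), ?_⟩
    have h1 : M.mulVec (M⁻¹.mulVec y) = y := by
      rw [Matrix.mulVec_mulVec, Matrix.mul_nonsing_inv _ hM, Matrix.one_mulVec]
    funext i
    conv_rhs => rw [← h1]
    simp only [Φ, LinearMap.pi_apply, map_sum, map_smul, galForm_single]
    simp [Matrix.mulVec, dotProduct, M, mul_comm]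
  have h := LinearMap.finrank_range_add_finrank_ker Φ
  rw [LinearMap.range_eq_top.2 hsurj, finrank_top] at h
  simp only [finrank_fintype_fun_eq_card, Fintype.card_fin, finrank_euclideanSpace] at h
  have h' : finrank ℝ (galSubspace σ ι θ d) = finrank ℝ (LinearMap.ker Φ) := rfl
  omega

/-- On a rational basis of `B`, the zeroth form takes values in `K` that are independent over `ℚ`,
so any `ℓ` consecutive conjugate forms have a nonzero Moore determinant. -/
theorem eq_zero_of_galForm_eq_zero {ℓ : ℕ} {B : Submodule ℝ (E n)}
    (hB : B ∈ rationalSubspaces n ℓ) (a : ℕ) :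
    ∀ y ∈ B, (∀ i : Fin ℓ, galForm σ ι θ (a + i) y = 0) → y = 0 := by
  obtain ⟨⟨b, hb⟩, rfl⟩ := hB
  choose q hq using hb
  rw [← formDet_ne_zero_iff b]
  have hli : LinearIndependent ℚ q := by
    rw [Fintype.linearIndependent_iff]
    intro c hc
    have h1 : ∑ j, (c j : ℝ) • b j = 0 := by
      apply Subtype.ext
      ext k
      have := congrFun hc k
      simp only [Finset.sum_apply, Pi.smul_apply, smul_eq_mul, Pi.zero_apply] at this
      have h2 : ((∑ j, c j * q j k : ℚ) : ℝ) = 0 := by rw [this, Rat.cast_zero]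
      push_cast at h2
      simpa [hq] using h2
    intro j
    exact_mod_cast Fintype.linearIndependent_iff.1 b.linearIndependent _ h1 j
  have hw := hli.map' (θ.equivFun.symm : (Fin n → ℚ) →ₗ[ℚ] K)
    (LinearEquiv.ker θ.equivFun.symm)
  have hdet := moore_det_ne_zero σ hfix _ hw a
  have h2 : formDet (fun i : Fin (finrank ℝ B) => galForm σ ι θ (a + i)) (fun j => (b j : E n)) =
      ι (Matrix.of fun i j : Fin (finrank ℝ B) => (σ ^ (a + (i : ℕ)))
        (((θ.equivFun.symm : (Fin n → ℚ) →ₗ[ℚ] K) ∘ q) j)).det := by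
    rw [RingHom.map_det, formDet, ← Matrix.det_transpose]
    congr 1
    ext i j
    simp only [galForm_apply, hq, Basis.equivFun_symm_apply, Matrix.transpose_apply,
      Matrix.of_apply, Function.comp_apply, LinearEquiv.coe_coe, RingHom.mapMatrix_apply,
      Matrix.map_apply, map_sum]
    refine sum_congr rfl fun k _ => ?_
    rw [Algebra.smul_def, map_mul, eq_ratCast, map_ratCast, map_mul,
      map_ratCast, mul_comm]
  rw [h2]
  exact fun h => hdet ((map_eq_zero _).1 h)

/-- The product is invariant under `σ`, hence rational; being integral over `ℤ` and nonzero, it is a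
nonzero integer. -/
theorem one_le_prod_conj (hσ : σ ^ n = 1) {x : K} (hx : x ≠ 0) (hint : IsIntegral ℤ x) :
    1 ≤ ∏ a ∈ range n, |ι ((σ ^ a) x)| := by
  set P := ∏ a ∈ range n, (σ ^ a) x with hP
  have h1 : σ P = P := by
    -- Splitting off either end of the product over `range (n + 1)` gives the invariance, since `σ ^
    -- n = 1`.
    have h2 := prod_range_succ (fun a => (σ ^ a) x) n
    rw [prod_range_succ', hσ, pow_zero] at h2
    have h3 := mul_right_cancel₀ (show (1 : K ≃ₐ[ℚ] K) x ≠ 0 from hx) h2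
    rw [hP, map_prod]
    simpa [pow_succ'] using h3
  obtain ⟨q, hq⟩ := hfix P h1
  have hPi : IsIntegral ℤ P := IsIntegral.prod _ fun a _ =>
    hint.map ((σ ^ a : K ≃ₐ[ℚ] K).toAlgHom.restrictScalars ℤ)
  rw [← hq, isIntegral_algebraMap_iff (algebraMap ℚ K).injective] at hPi
  obtain ⟨z, hz⟩ := IsIntegrallyClosed.isIntegral_iff.1 hPi
  have hP0 : P ≠ 0 := prod_ne_zero_iff.2 fun a _ => (map_ne_zero _).2 hx
  have h4 : ι P = (z : ℝ) := by
    rw [← hq, ← hz]; simp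
  rw [← abs_prod, ← map_prod, ← hP, h4]
  have hz0 : z ≠ 0 := by
    rintro rfl
    rw [Int.cast_zero] at h4
    exact hP0 ((map_eq_zero _).1 h4)
  exact_mod_cast Int.one_le_abs hz0

-- Expanding the determinant into integer minors leaves coefficients in `K`; the minors are fixed by
-- `σ`, so shifting the window by `a` applies `σ ^ a`.
omit hfix in
theorem exists_formDet_galForm_eq (hθ : ∀ k, IsIntegral ℤ (θ k)) {ℓ : ℕ}
    (Ξ : (Fin ℓ ↪o Fin n) → ℤ) (v : Fin ℓ → E n) (c : ℝ)
    (hc : ∀ S, (Ξ S : ℝ) = c * plucker v S) :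
    ∃ x : K, IsIntegral ℤ x ∧ ∀ a, c * formDet (fun i => galForm σ ι θ (a + i)) v =
      ι ((σ ^ a) x) := by
  choose z _ hz using exists_int_minor Ξ
  refine ⟨∑ κ : Fin ℓ → Fin n, (∏ i : Fin ℓ, (σ ^ (i : ℕ)) (θ (κ i))) * (z κ : K), ?_, fun a => ?_⟩
  · refine IsIntegral.sum _ fun κ _ => IsIntegral.mul (IsIntegral.prod _ fun i _ => ?_)
      (isIntegral_algebraMap (R := ℤ) (A := K) (x := z κ))
    exact (hθ _).map ((σ ^ (i : ℕ) : K ≃ₐ[ℚ] K).toAlgHom.restrictScalars ℤ)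
  · rw [formDet_eq_sum, mul_sum, map_sum, map_sum]
    refine sum_congr rfl fun κ _ => ?_
    rw [mul_left_comm, hz κ v c hc]
    simp only [galForm_single, pow_add, AlgEquiv.mul_apply, map_mul, map_prod, map_intCast]

omit hfix in
theorem exists_conj_bound : ∃ C : ℝ, 1 ≤ C ∧ ∀ i k, |ι ((σ ^ i) (θ k))| ≤ C := by
  have := Fintype.ofFinite (K ≃ₐ[ℚ] K)
  refine ⟨1 + ∑ p : (K ≃ₐ[ℚ] K) × Fin n, |ι (p.1 (θ p.2))|,
    le_add_of_nonneg_right (sum_nonneg fun _ _ => abs_nonneg _), fun i k => ?_⟩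
  have := single_le_sum (f := fun p : (K ≃ₐ[ℚ] K) × Fin n => |ι (p.1 (θ p.2))|)
    (fun _ _ => abs_nonneg _) (mem_univ (σ ^ i, k))
  dsimp only at this
  linarith

-- The forms of the window vanish at `X`, so their values at `Y` are those at `Y - t • X`, of size
-- `O(ψ ‖Y‖)`. Cramer's rule writes each `Y k` times the determinant through these values and minors
-- bounded by the norm of `Ξ`.
omit hfix in
theorem abs_formDet_galForm_le {C : ℝ} (hC : 1 ≤ C) (hCb : ∀ i k, |ι ((σ ^ i) (θ k))| ≤ C)
    {d ℓ a : ℕ} (had : a + ℓ ≤ d) {B : Submodule ℝ (E n)} (Ξ : (Fin ℓ ↪o Fin n) → ℤ)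
    (v : Basis (Fin ℓ) ℝ B) (c : ℝ) (hc : ∀ S, (Ξ S : ℝ) = c * plucker (fun i => (v i : E n)) S)
    {X Y : E n} (hX : X ∈ galSubspace σ ι θ d) (hX0 : X ≠ 0) (hY : Y ∈ B) (hY0 : Y ≠ 0) :
    |c * formDet (fun i => galForm σ ι θ (a + i)) (fun j => (v j : E n))| ≤
      n * (ℓ * (n * C) * (n ^ ℓ * C ^ ℓ)) * √(∑ S, (Ξ S : ℝ) ^ 2) * psiVec X Y := by
  set N := √(∑ S, (Ξ S : ℝ) ^ 2)
  set s := psiVec X Y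
  let f : Fin ℓ → E n →ₗ[ℝ] ℝ := fun i => galForm σ ι θ (a + i)
  set Δ := c * formDet f (fun j => (v j : E n)) with hΔ
  have hN : 0 ≤ N := Real.sqrt_nonneg _
  have hs : 0 ≤ s := InnerProductGeometry.sin_angle_nonneg _ _
  have hYn : 0 < ‖Y‖ := norm_pos_iff.2 hY0
  obtain ⟨t, ht⟩ := exists_norm_sub_smul_eq hX0 Y
  have hf : ∀ i, |f i Y| ≤ n * C * (s * ‖Y‖) := by
    intro i
    have h1 : f i Y = f i (Y - t • X) := by
      rw [map_sub, map_smul, (mem_galSubspace σ ι θ).1 hX (a + i) (by omega), smul_zero, sub_zero]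
    rw [h1, ← ht, galForm_apply]
    refine (abs_sum_le_sum_abs _ _).trans ?_
    refine (sum_le_sum (g := fun _ => C * ‖Y - t • X‖) fun k _ => ?_).trans (by simp [mul_assoc])
    rw [abs_mul]
    exact mul_le_mul (hCb _ _) (PiLp.norm_apply_le (Y - t • X) k) (abs_nonneg _) (by linarith)
  have hk : ∀ k, |Y k| * |Δ| ≤ ℓ * (n * C) * (n ^ ℓ * C ^ ℓ) * N * s * ‖Y‖ := by
    intro k
    have h1 := formDet_cramer f (coordForm k) (fun j => (v j : E n))
      (y := Y) (by rwa [span_range_basis])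
    have h2 : Y k * Δ = ∑ i, f i Y *
        (c * formDet (Function.update f i (coordForm k)) (fun j => (v j : E n))) := by
      rw [hΔ, mul_left_comm]
      change c * (coordForm k Y * _) = _
      rw [h1, mul_sum]
      exact sum_congr rfl fun i _ => by ring
    rw [← abs_mul, h2]
    refine (abs_sum_le_sum_abs _ _).trans ?_
    refine (sum_le_sum (g := fun _ => n * C * (s * ‖Y‖) * (n ^ ℓ * C ^ ℓ * N))
      fun i _ => ?_).trans ?_
    · rw [abs_mul]
      refine mul_le_mul (hf i) (formDet_bound Ξ _ c hc _ fun j k' => ?_) (abs_nonneg _)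
        (by positivity)
      by_cases hj : j = i
      · subst hj
        rw [Function.update_self, coordForm_apply, PiLp.single_apply]
        split_ifs <;> simp <;> linarith
      · rw [Function.update_of_ne hj, galForm_single]
        exact hCb _ _
    · simp only [sum_const, card_univ, Fintype.card_fin, nsmul_eq_mul]
      apply le_of_eq; ring
  have h3 : ‖Y‖ * |Δ| ≤ ‖Y‖ * (n * (ℓ * (n * C) * (n ^ ℓ * C ^ ℓ)) * N * s) := by
    calc ‖Y‖ * |Δ| ≤ (∑ k, |Y k|) * |Δ| :=
          mul_le_mul_of_nonneg_right (norm_le_sum_abs Y) (abs_nonneg _)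
      _ = ∑ k, |Y k| * |Δ| := sum_mul _ _ _
      _ ≤ ∑ k : Fin n, ℓ * (n * C) * (n ^ ℓ * C ^ ℓ) * N * s * ‖Y‖ := sum_le_sum fun k _ => hk k
      _ = _ := by
        simp only [sum_const, card_univ, Fintype.card_fin, nsmul_eq_mul]
        ring
  exact le_of_mul_le_mul_left h3 hYn

/-- Rational subspaces stay away from `galSubspace`. -/
theorem exists_lower_bound (hσ : σ ^ n = 1) (hθ : ∀ k, IsIntegral ℤ (θ k)) {d ℓ : ℕ}
    (hℓ : 1 ≤ ℓ) (hℓd : ℓ ≤ d) (hdn : d ≤ n) :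
    ∃ C : ℝ, 0 < C ∧ ∀ B ∈ rationalSubspaces n ℓ, ∀ X ∈ galSubspace σ ι θ d, ∀ Y ∈ B,
      X ≠ 0 → Y ≠ 0 → 1 ≤ C * psiVec X Y ^ (d - ℓ + 1) * height B ^ n := by
  obtain ⟨C, hC, hCb⟩ := exists_conj_bound σ ι θ
  have hn : 0 < n := by omega
  obtain ⟨r, hr⟩ : ∃ r, n = (d - ℓ + 1) + r := ⟨n - (d - ℓ + 1), by omega⟩
  set m := d - ℓ + 1 with hm
  set C₂ : ℝ := n ^ ℓ * C ^ ℓ with hC₂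
  set C₄ : ℝ := n * (ℓ * (n * C) * C₂) with hC₄
  have hn' : (0 : ℝ) < n := by exact_mod_cast hn
  have hℓ' : (0 : ℝ) < ℓ := by exact_mod_cast hℓ
  have hC₂p : 0 < C₂ := by positivity
  have hC₄p : 0 < C₄ := by positivity
  -- `C₄` serves the `m` windows contained in the first `d` forms, `C₂` the other `r`; the `2` comes
  -- from the norm of `Ξ` being at most `2 * height B`.
  refine ⟨C₄ ^ m * C₂ ^ r * 2 ^ n, by positivity, fun B hB X hX Y hY hX0 hY0 => ?_⟩
  obtain ⟨Ξ, ⟨-, v, c, hc0, hc⟩, hN2⟩ := exists_isPrimitivePlucker_norm_le hB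
  obtain ⟨x, hxi, hx⟩ := exists_formDet_galForm_eq σ ι θ hθ Ξ (fun j => (v j : E n)) c hc
  have hx0 : x ≠ 0 := by
    rintro rfl
    have h1 := hx 0
    rw [map_zero, map_zero] at h1
    refine mul_ne_zero hc0 ?_ h1
    rw [formDet_ne_zero_iff v]
    exact eq_zero_of_galForm_eq_zero σ ι θ hfix hB 0
  have hprod := one_le_prod_conj σ ι hfix hσ hx0 hxi
  set N := √(∑ S, (Ξ S : ℝ) ^ 2)
  set s := psiVec X Y
  have hN : 0 ≤ N := Real.sqrt_nonneg _
  have hs : 0 ≤ s := InnerProductGeometry.sin_angle_nonneg _ _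
  have hb1 : ∀ a ∈ range m, |ι ((σ ^ a) x)| ≤ C₄ * N * s := fun a ha => by
    rw [← hx a]
    have := mem_range.1 ha
    exact abs_formDet_galForm_le σ ι θ hC hCb (d := d) (by omega) Ξ v c hc hX hX0 hY hY0
  have hb2 : ∀ a ∈ range r, |ι ((σ ^ (m + a)) x)| ≤ C₂ * N := fun a _ => by
    rw [← hx]
    exact formDet_bound Ξ _ c hc _ fun i k => by rw [galForm_single]; exact hCb _ _
  have h1 : ∏ a ∈ range n, |ι ((σ ^ a) x)| ≤ (C₄ * N * s) ^ m * (C₂ * N) ^ r := by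
    rw [hr, prod_range_add]
    refine mul_le_mul ?_ ?_ (prod_nonneg fun _ _ => abs_nonneg _) (by positivity)
    · simpa using prod_le_prod (fun _ _ => abs_nonneg _) hb1
    · simpa using prod_le_prod (fun _ _ => abs_nonneg _) hb2
  calc (1 : ℝ) ≤ (C₄ * N * s) ^ m * (C₂ * N) ^ r := hprod.trans h1
    _ = C₄ ^ m * C₂ ^ r * s ^ m * N ^ n := by rw [hr]; ring
    _ ≤ C₄ ^ m * C₂ ^ r * s ^ m * (2 * height B) ^ n :=
      mul_le_mul_of_nonneg_left (pow_le_pow_left₀ hN hN2 n) (by positivity)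
    _ = _ := by rw [mul_pow]; ring

theorem galSubspace_mem_irrationalSubspaces {d ℓ : ℕ} (hℓd : ℓ ≤ d) (hdn : d ≤ n) :
    galSubspace σ ι θ d ∈ irrationalSubspaces n (n - d) ℓ 1 := by
  refine ⟨finrank_galSubspace σ ι θ hfix hdn, fun B hB => ?_⟩
  have : galSubspace σ ι θ d ⊓ B = ⊥ := by
    rw [eq_bot_iff]
    rintro y ⟨hy, hyB⟩
    refine eq_zero_of_galForm_eq_zero σ ι θ hfix hB 0 y hyB fun i => ?_
    exact (mem_galSubspace σ ι θ).1 hy _ (by omega)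
  rw [this, finrank_bot]
  exact one_pos

/-- If `β * m > n`, the lower bound for angles turns `ψ₁ ≤ H ^ (-β)` into a bound on `H`, which
leaves finitely many `B`. -/
theorem exponent_galSubspace_le (hσ : σ ^ n = 1) (hθ : ∀ k, IsIntegral ℤ (θ k)) {d ℓ : ℕ}
    (hℓ : 1 ≤ ℓ) (hℓd : ℓ ≤ d) (hdn : d < n) :
    exponent (galSubspace σ ι θ d) ℓ 1 ≤ ENNReal.ofReal (n / ((d - ℓ + 1 : ℕ) : ℝ)) := by
  refine sSup_le ?_
  rintro _ ⟨β, -, hinf, rfl⟩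
  refine ENNReal.ofReal_le_ofReal ?_
  by_contra! hβ
  obtain ⟨C, hC, hbound⟩ := exists_lower_bound σ ι θ hfix hσ hθ hℓ hℓd hdn.le
  set m := d - ℓ + 1 with hm
  have hm0 : (0 : ℝ) < (m : ℝ) := by rw [hm]; positivity
  have hγ : 0 < β * m - n := by
    rw [div_lt_iff₀ hm0] at hβ
    linarith
  refine hinf ((finite_height_le n ℓ (C ^ (β * m - n)⁻¹)).subset ?_)
  rintro B ⟨hB, hψ⟩
  refine ⟨hB, ?_⟩
  have hH1 := hB.1.one_le_height
  set H := height B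
  have hH : 0 < H := by linarith
  set ρ : ℝ := (1 / (C * H ^ n)) ^ ((m : ℝ)⁻¹) with hρ
  have hρ0 : 0 ≤ ρ := by positivity
  have hρm : ρ ^ m = 1 / (C * H ^ n) := Real.rpow_inv_natCast_pow (by positivity) (by omega)
  have hle : ρ ≤ psiOne (galSubspace σ ι θ d) B := by
    refine le_csInf ?_ ?_
    -- The infimum of the empty set is `0`, so both subspaces must be nonzero; this uses `d < n` and
    -- `1 ≤ ℓ`.
    · have h1 : galSubspace σ ι θ d ≠ ⊥ := by
        intro h0
        have := finrank_galSubspace σ ι θ hfix hdn.le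
        rw [h0, finrank_bot] at this
        omega
      have h2 : B ≠ ⊥ := by
        rintro rfl
        have := hB.2
        rw [finrank_bot] at this
        omega
      obtain ⟨X, hX, hX0⟩ := Submodule.exists_mem_ne_zero_of_ne_bot h1
      obtain ⟨Y, hY, hY0⟩ := Submodule.exists_mem_ne_zero_of_ne_bot h2
      exact ⟨_, X, hX, Y, hY, hX0, hY0, rfl⟩
    · rintro _ ⟨X, hX, Y, hY, hX0, hY0, rfl⟩
      have hs : 0 ≤ psiVec X Y := InnerProductGeometry.sin_angle_nonneg _ _
      rw [← pow_le_pow_iff_left₀ hρ0 hs (n := m) (by omega), hρm, div_le_iff₀ (by positivity)]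
      have := hbound B hB X hX Y hY hX0 hY0
      linarith
  have h1 : ρ ^ m ≤ (1 / H ^ β) ^ m := pow_le_pow_left₀ hρ0 (hle.trans hψ) m
  rw [hρm, div_pow, one_pow, ← Real.rpow_mul_natCast hH.le,
    one_div_le_one_div (by positivity) (by positivity)] at h1
  have h2 : H ^ (β * m - n) ≤ C := by
    rw [Real.rpow_sub hH, Real.rpow_natCast, div_le_iff₀ (by positivity)]
    exact h1
  rwa [Real.le_rpow_inv_iff_of_pos hH.le hC.le hγ]

end GalForm

/-! ### Bounds for the minimal exponent -/

theorem minExponent_le {n d ℓ : ℕ} (hℓ : 1 ≤ ℓ) (hℓd : ℓ ≤ d) (hdn : d < n) :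
    minExponent n (n - d) ℓ 1 ≤ ENNReal.ofReal (n / ((d - ℓ + 1 : ℕ) : ℝ)) := by
  obtain ⟨K, _, _, σ, ι, hdeg, hσ, hfix⟩ := exists_real_cyclic_field n (by omega)
  have e : Free.ChooseBasisIndex ℤ (NumberField.RingOfIntegers K) ≃ Fin n := by
    refine Fintype.equivFinOfCardEq ?_
    rw [← hdeg, finrank_eq_card_basis (NumberField.integralBasis K)]
  let θ : Basis (Fin n) ℚ K := (NumberField.integralBasis K).reindex e
  have hθ : ∀ k, IsIntegral ℤ (θ k) := fun k => by
    simp only [θ, Basis.reindex_apply, NumberField.integralBasis_apply]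
    exact NumberField.RingOfIntegers.isIntegral_coe _
  exact (iInf₂_le _ (galSubspace_mem_irrationalSubspaces σ ι θ hfix hℓd hdn.le)).trans
    (exponent_galSubspace_le σ ι θ hfix hσ hθ hℓ hℓd hdn)

end SubspaceApprox

theorem mainTheorem3 (d ℓ : ℕ) (hd : 2 ≤ d) (hℓ₁ : 1 ≤ ℓ) (hℓ₂ : ℓ ≤ d) :
    SubspaceApprox.minExponent (2 * d) d ℓ 1 ≤
      ENNReal.ofReal (2 * (d : ℝ) ^ 2 / (2 * (d : ℝ) - (ℓ : ℝ))) := by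
  have h := SubspaceApprox.minExponent_le (n := 2 * d) hℓ₁ hℓ₂ (by omega)
  rw [show 2 * d - d = d by omega] at h
  refine h.trans (ENNReal.ofReal_le_ofReal ?_)
  have h1 : (1 : ℝ) ≤ ℓ := by exact_mod_cast hℓ₁
  have h2 : (ℓ : ℝ) ≤ d := by exact_mod_cast hℓ₂
  have h3 : (2 : ℝ) ≤ d := by exact_mod_cast hd
  push_cast [Nat.cast_sub hℓ₂]
  rw [div_le_div_iff₀ (by linarith) (by linarith)]
  -- After clearing denominators the difference is `2 * d * (d - 1) * (d - ℓ)`.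
  nlinarith [mul_nonneg (mul_nonneg (by linarith : (0 : ℝ) ≤ d) (by linarith : (0 : ℝ) ≤ d - 1))
    (by linarith : (0 : ℝ) ≤ d - ℓ)]
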